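/- Let $\mathcal A,\mathcal B$ be bicategories and $U:\mathcal A\to\mathcal B$ a pseudofunctor. Definitions. For an object $X$ of a bicategory $\mathcal C$, the pseudoslice $\mathcal C/X$ has as 0-cells the 1-cells $f:B\to X$, as 1-cells $f\to g$ the pairs $(k,\kappa)$ with $\kappa: g k\cong f$ an invertible 2-cell, and as 2-cells $(k,\kappa)\Rightarrow(l,\lambda)$ the 2-cells $\phi:k\Rightarrow l$ with $\lambda\cdot(g\phi)=\kappa$; $U$ induces pseudofunctors $U_A:\mathcal A/A\to\mathcal B/U(A)$. A left biadjoint of a pseudofunctor $R:\mathcal C\to\mathcal D$ is a pseudofunctor $L:\mathcal D\to\mathcal C$ with a pseudonatural transformation $\eta:1\Rightarrow RL$ (the unit) such that $w\mapsto R(w)\eta_d$ is an equivalence of categories $\mathcal C(Ld,c)\simeq\mathcal D(d,Rc)$ for all $d,c$. $U$ is a local right biadjoint if every $U_A$ has a left biadjoint $L_A$; the unit of $L_A$ at $f:B\to U(A)$ is then a pair $(h^A_f,\eta^A_f)$ with $h^A_f:B\to U(A_f)$, $L_A(f):A_f\to A$ and $\eta^A_f:U(L_A(f))h^A_f\cong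 f$, and a 1-cell $h^A_f$ arising in this way (for some $A$, some left biadjoint $L_A$ of $U_A$ and some $f$) is called a local unit. A filler of an invertible 2-cell $\alpha:U(u)f\cong U(v)n$, where $n:B\to U(A)$, $f:B\to U(A_1)$, $u:A_1\to A_2$, $v:A\to A_2$, is a triple $(w,\nu,\omega)$ with $w:A\to A_1$ and invertible 2-cells $\nu:f\cong U(w)n$, $\omega:uw\cong v$ such that the pasting of $\nu$ and $U(\omega)$ is $\alpha$. A 1-cell $n:B\to U(A)$ is $U$-generic if every such $\alpha$ has a filler, any two fillers of $\alpha$ are related by a unique invertible 2-cell $w\cong w'$ compatible with the $\nu$'s and $\omega$'s, and for every $\phi:f_1\Rightarrow f_2$ with $\alpha_2\cdot(U(u)\phi)=\alpha_1$ and all fillers $(w_i,\nu_i,\omega_i)$ of $\alpha_i$ there is a unique 2-cell $\sigma:w_1\Rightarrow w_2$ with $\omega_2\cdot(u\sigma)=\omega_1$ and $(U(\sigma)n)\cdot\nu_1=\nu_2\cdot\phi$. A generic factorization of $f:B\to U(A)$ is an invertible 2-cell $\alpha_f:U(u_f)n_f\cong f$ with $u_f:A_f\to A$ and $n_f:B\to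 U(A_f)$ $U$-generic. $U$ is bistable if every $f:B\to U(A)$ has a generic factorization $(A_f,n_f,u_f,\alpha_f)$ such that for every generic factorization $(A',n,u,\alpha)$ of $f$ there are an equivalence $e:A'\simeq A_f$ in $\mathcal A$ and invertible 2-cells $\nu:U(e)n\cong n_f$, $\omega:u_fe\cong u$ whose pasting with $\alpha_f$ is $\alpha$, the triple $(e,\nu,\omega)$ being unique up to a unique compatible invertible 2-cell. Theorem. (1) $U$ is bistable if and only if it is a local right biadjoint. (2) If $U$ is bistable, then a 1-cell $n:B\to U(A)$ is $U$-generic if and only if it is a local unit. (3) For any choice of left biadjoints $L_A$ of all the $U_A$, every unit component $h^A_f$ is $U$-generic, and a 1-cell $n:B\to U(A)$ is $U$-generic if and only if $L_A(n):A_n\to A$ is an equivalence in $\mathcal A$. (4) For every object $A$ and every choice of generic factorizations $(A_f,n_f,u_f,\alpha_f)$ of all 1-cells $f:B\to U(A)$ (all $B$), $U_A$ has a left biadjoint $L_A$ with $L_A(f)=u_f$ and unit $(n_f,\alpha_f)$ at every $f$. -/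

import Mathlib

open CategoryTheory Bicategory

universe w₁ w₂ v₁ v₂ u₁ u₂

namespace TwoDimStability

section Slice

variable {B : Type u₁} [Bicategory.{w₁, v₁} B]

/-- A 1-cell of a bicategory is an equivalence if it underlies an (adjoint) equivalence. -/
def IsEquivalence₁ {a b : B} (e : a ⟶ b) : Prop :=
  ∃ E : Bicategory.Equivalence a b, E.hom = e

/-- The 0-cells of the pseudoslice `B/x`: the 1-cells of `B` with codomain `x`. -/
structure PseudoSlice (x : B) where
  /-- the domain -/
  left : B
  /-- the structure 1-cell -/
  hom : left ⟶ x

namespace PseudoSlice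

variable {x : B}

/-- The 1-cells `(left, iso)` of the pseudoslice: triangles filled by an invertible 2-cell. -/
structure Hom₁ (f g : PseudoSlice x) where
  /-- the underlying 1-cell -/
  left : f.left ⟶ g.left
  /-- the invertible 2-cell filling the triangle -/
  iso : left ≫ g.hom ≅ f.hom

instance : CategoryStruct (PseudoSlice x) where
  Hom f g := Hom₁ f g
  id f := ⟨𝟙 f.left, λ_ f.hom⟩
  comp {_ _ h} k l :=
    ⟨k.left ≫ l.left, α_ k.left l.left h.hom ≪≫ whiskerLeftIso k.left l.iso ≪≫ k.iso⟩

/-- The 2-cells `(u, α) ⟶ (u', α')` of the pseudoslice: 2-cells `u ⟶ u'` of `B` compatible with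
the triangles. -/
@[ext]
structure Hom₂ {f g : PseudoSlice x} (k l : f ⟶ g) where
  /-- the underlying 2-cell -/
  left : k.left ⟶ l.left
  w : left ▷ g.hom ≫ l.iso.hom = k.iso.hom

instance homCat (f g : PseudoSlice x) : Category (f ⟶ g) where
  Hom k l := Hom₂ k l
  id k := ⟨𝟙 k.left, by simp⟩
  comp φ ψ := ⟨φ.left ≫ ψ.left, by simp [φ.w, ψ.w]⟩
  id_comp φ := Hom₂.ext (Category.id_comp _)
  comp_id φ := Hom₂.ext (Category.comp_id _)
  assoc φ ψ χ := Hom₂.ext (Category.assoc _ _ _)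

@[ext]
theorem hom₂_ext {f g : PseudoSlice x} {k l : f ⟶ g} {φ ψ : k ⟶ l} (h : φ.left = ψ.left) :
    φ = ψ := Hom₂.ext h

@[simp]
theorem id_left₁ (f : PseudoSlice x) : (𝟙 f : f ⟶ f).left = 𝟙 f.left := rfl

@[simp]
theorem comp_left₁ {f g h : PseudoSlice x} (k : f ⟶ g) (l : g ⟶ h) :
    (k ≫ l).left = k.left ≫ l.left := rfl

@[simp]
theorem id_iso (f : PseudoSlice x) : (𝟙 f : f ⟶ f).iso = λ_ f.hom := rfl

@[simp]
theorem comp_iso {f g h : PseudoSlice x} (k : f ⟶ g) (l : g ⟶ h) :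
    (k ≫ l).iso = α_ k.left l.left h.hom ≪≫ whiskerLeftIso k.left l.iso ≪≫ k.iso := rfl

@[simp]
theorem id_left₂ {f g : PseudoSlice x} (k : f ⟶ g) : (𝟙 k : k ⟶ k).left = 𝟙 k.left := rfl

@[simp]
theorem comp_left₂ {f g : PseudoSlice x} {k l m : f ⟶ g} (φ : k ⟶ l) (ψ : l ⟶ m) :
    (φ ≫ ψ).left = φ.left ≫ ψ.left := rfl

/-- An invertible 2-cell of `B` compatible with the triangles is invertible in the pseudoslice. -/
def mkIso {f g : PseudoSlice x} {k l : f ⟶ g} (φ : k.left ≅ l.left)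
    (w : φ.hom ▷ g.hom ≫ l.iso.hom = k.iso.hom) : k ≅ l where
  hom := ⟨φ.hom, w⟩
  inv := ⟨φ.inv, by rw [← w]; simp⟩
  hom_inv_id := hom₂_ext φ.hom_inv_id
  inv_hom_id := hom₂_ext φ.inv_hom_id

@[simp]
theorem mkIso_hom_left {f g : PseudoSlice x} {k l : f ⟶ g} (φ : k.left ≅ l.left)
    (w : φ.hom ▷ g.hom ≫ l.iso.hom = k.iso.hom) : (mkIso φ w).hom.left = φ.hom := rfl

@[simp]
theorem mkIso_inv_left {f g : PseudoSlice x} {k l : f ⟶ g} (φ : k.left ≅ l.left)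
    (w : φ.hom ▷ g.hom ≫ l.iso.hom = k.iso.hom) : (mkIso φ w).inv.left = φ.inv := rfl

/-- The pseudoslice bicategory `B/x`; its structural 2-cells are those of `B`. -/
instance bicategory : Bicategory (PseudoSlice x) where
  homCategory := homCat
  whiskerLeft k _ _ φ := ⟨k.left ◁ φ.left, by simp [← φ.w]⟩
  whiskerRight {f g h k l} φ m := ⟨φ.left ▷ m.left, by
    have := φ.w
    simp [← this, whisker_exchange_assoc]⟩
  associator k l m := mkIso (α_ k.left l.left m.left) (by simp)
  leftUnitor k := mkIso (λ_ k.left) (by simp)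
  rightUnitor k := mkIso (ρ_ k.left) (by simp)
  whisker_exchange φ ψ := hom₂_ext (whisker_exchange φ.left ψ.left)

end PseudoSlice

end Slice

section Restriction

variable {A : Type u₁} [Bicategory.{w₁, v₁} A] {B : Type u₂} [Bicategory.{w₂, v₂} B]

/-- The restriction `U_a : A/a ⥤ᵖ B/U(a)` of a pseudofunctor `U` to pseudoslices, sending a
triangle `(w, ω)` to `U(w)` with `U(ω)` corrected by the compositor of `U`. -/
def sliceRestriction (U : A ⥤ᵖ B) (a : A) : PseudoSlice a ⥤ᵖ PseudoSlice (U.obj a) where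
  obj u := ⟨U.obj u.left, U.map u.hom⟩
  map {u v} k := ⟨U.map k.left, (U.mapComp k.left v.hom).symm ≪≫ U.map₂Iso k.iso⟩
  map₂ {u v k l} φ := ⟨U.map₂ φ.left, by
    have := φ.w
    simp [← this]⟩
  mapId u := PseudoSlice.mkIso (U.mapId u.left) (by simp)
  mapComp {_ v w} k l := PseudoSlice.mkIso (U.mapComp k.left l.left) (by
    change (U.mapComp k.left l.left).hom ▷ U.map w.hom ≫
      (α_ _ _ _).hom ≫ U.map k.left ◁ ((U.mapComp l.left w.hom).inv ≫ U.map₂ l.iso.hom) ≫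
        (U.mapComp k.left v.hom).inv ≫ U.map₂ k.iso.hom =
      (U.mapComp (k.left ≫ l.left) w.hom).inv ≫
        U.map₂ ((α_ _ _ _).hom ≫ k.left ◁ l.iso.hom ≫ k.iso.hom)
    simp)
  map₂_whisker_left k _ _ φ := PseudoSlice.hom₂_ext (U.map₂_whisker_left k.left φ.left)
  map₂_whisker_right φ m := PseudoSlice.hom₂_ext (U.map₂_whisker_right φ.left m.left)
  map₂_associator k l m := PseudoSlice.hom₂_ext (U.map₂_associator k.left l.left m.left)
  map₂_left_unitor k := PseudoSlice.hom₂_ext (U.map₂_left_unitor k.left)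
  map₂_right_unitor k := PseudoSlice.hom₂_ext (U.map₂_right_unitor k.left)

end Restriction

section Biadjoint

variable {C : Type u₁} [Bicategory.{w₁, v₁} C] {D : Type u₂} [Bicategory.{w₂, v₂} D]

/-- Given a 1-cell `h : d ⟶ R c`, the functor between hom-categories `C(c, u) ⥤ D(d, R u)` which
applies `R` and precomposes with `h`. -/
def transpose (R : C ⥤ᵖ D) {c : C} {d : D} (h : d ⟶ R.obj c) (u : C) :
    (c ⟶ u) ⥤ (d ⟶ R.obj u) where
  obj w := h ≫ R.map w
  map σ := h ◁ R.map₂ σ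

/-- A left biadjoint of a pseudofunctor `R : C ⥤ᵖ D`: a pseudofunctor `L : D ⥤ᵖ C` and a
pseudonatural transformation `unit : 𝟭 ⟶ R L` such that applying `R` and precomposing with
the unit is an equivalence of hom-categories `C(L d, u) ≌ D(d, R u)` for all `d` and `u`. -/
structure LeftBiadjoint (R : C ⥤ᵖ D) where
  /-- the left biadjoint -/
  L : D ⥤ᵖ C
  /-- the unit of the biadjunction -/
  unit : Pseudofunctor.StrongTrans (Pseudofunctor.id D) (L.comp R)
  isEquivalence_transpose (d : D) (u : C) :
    (transpose R (c := L.obj d) (unit.app d) u).IsEquivalence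

end Biadjoint

section Stability

variable {A : Type u₁} [Bicategory.{w₁, v₁} A] {B : Type u₂} [Bicategory.{w₂, v₂} B]

/-- A pseudofunctor `U` is a local right biadjoint if each of its restrictions to pseudoslices has
a left biadjoint. -/
def IsLocalRightBiadjoint (U : A ⥤ᵖ B) : Prop :=
  ∀ a : A, Nonempty (LeftBiadjoint (sliceRestriction U a))

/-- A diagonal filler of a pseudosquare `α : U(u) f ≅ U(v) n` from `n` to `U(u)`: a 1-cell `diag`
with invertible 2-cells `ν : f ≅ U(diag) n` and `ω : u diag ≅ v` whose pasting is `α`. -/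
structure Filler (U : A ⥤ᵖ B) {b : B} {a a₁ a₂ : A} (n : b ⟶ U.obj a) (u : a₁ ⟶ a₂) (v : a ⟶ a₂)
    (f : b ⟶ U.obj a₁) (α : f ≫ U.map u ≅ n ≫ U.map v) where
  /-- the diagonal -/
  diag : a ⟶ a₁
  /-- the upper triangle, in `B` -/
  ν : f ≅ n ≫ U.map diag
  /-- the lower triangle, in `A` -/
  ω : diag ≫ u ≅ v
  pasting : ν.hom ▷ U.map u ≫ (α_ n (U.map diag) (U.map u)).hom ≫
    n ◁ (U.mapComp diag u).inv ≫ n ◁ U.map₂ ω.hom = α.hom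

/-- A 1-cell `n : b ⟶ U a` is `U`-generic if every pseudosquare from `n` to some `U(u)` with bottom
side some `U(v)` has a filler, unique up to a unique compatible invertible 2-cell, and every
morphism of such pseudosquares (given by a 2-cell `φ` on the top side) induces a unique compatible
2-cell between the fillers. -/
structure IsGeneric (U : A ⥤ᵖ B) {b : B} {a : A} (n : b ⟶ U.obj a) : Prop where
  exists_filler {a₁ a₂ : A} (u : a₁ ⟶ a₂) (v : a ⟶ a₂) (f : b ⟶ U.obj a₁)
    (α : f ≫ U.map u ≅ n ≫ U.map v) : Nonempty (Filler U n u v f α)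
  existsUnique_iso {a₁ a₂ : A} {u : a₁ ⟶ a₂} {v : a ⟶ a₂} {f : b ⟶ U.obj a₁}
    {α : f ≫ U.map u ≅ n ≫ U.map v} (F F' : Filler U n u v f α) :
    ∃! θ : F.diag ≅ F'.diag,
      θ.hom ▷ u ≫ F'.ω.hom = F.ω.hom ∧ F.ν.hom ≫ n ◁ U.map₂ θ.hom = F'.ν.hom
  existsUnique_two_cell {a₁ a₂ : A} {u : a₁ ⟶ a₂} {v : a ⟶ a₂} {f₁ f₂ : b ⟶ U.obj a₁}
    {α₁ : f₁ ≫ U.map u ≅ n ≫ U.map v} {α₂ : f₂ ≫ U.map u ≅ n ≫ U.map v}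
    (φ : f₁ ⟶ f₂) (_ : φ ▷ U.map u ≫ α₂.hom = α₁.hom)
    (F₁ : Filler U n u v f₁ α₁) (F₂ : Filler U n u v f₂ α₂) :
    ∃! σ : F₁.diag ⟶ F₂.diag,
      σ ▷ u ≫ F₂.ω.hom = F₁.ω.hom ∧ F₁.ν.hom ≫ n ◁ U.map₂ σ = φ ≫ F₂.ν.hom

/-- A generic factorization `U(right) left ≅ f` of `f : b ⟶ U a`: its left part is `U`-generic. -/
structure GenericFactorization (U : A ⥤ᵖ B) {b : B} {a : A} (f : b ⟶ U.obj a) where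
  /-- the middle object -/
  mid : A
  /-- the generic part -/
  left : b ⟶ U.obj mid
  /-- the right part, in `A` -/
  right : mid ⟶ a
  /-- the invertible 2-cell filling the triangle -/
  iso : left ≫ U.map right ≅ f
  generic : IsGeneric U left

/-- A comparison from a generic factorization `G` of `f` to another one `F`: an equivalence `e`
between the middle objects with invertible 2-cells `ν : U(e) n_G ≅ n_F` in `B` and
`ω : u_F e ≅ u_G` in `A` whose pasting with the 2-cell of `F` is the 2-cell of `G`. -/
structure Comparison (U : A ⥤ᵖ B) {b : B} {a : A} {f : b ⟶ U.obj a}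
    (G F : GenericFactorization U f) where
  /-- the underlying 1-cell -/
  e : G.mid ⟶ F.mid
  isEquivalence : IsEquivalence₁ e
  /-- the left triangle -/
  ν : G.left ≫ U.map e ≅ F.left
  /-- the right triangle -/
  ω : e ≫ F.right ≅ G.right
  pasting : G.left ◁ U.map₂ ω.inv ≫ G.left ◁ (U.mapComp e F.right).hom ≫
    (α_ G.left (U.map e) (U.map F.right)).inv ≫ ν.hom ▷ U.map F.right ≫ F.iso.hom = G.iso.hom

/-- A pseudofunctor `U` is bistable if every `f : b ⟶ U a` has a generic factorization, to which
every generic factorization of `f` is compared by an equivalence that is unique up to a unique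
compatible invertible 2-cell. -/
def IsBistable (U : A ⥤ᵖ B) : Prop :=
  ∀ ⦃b : B⦄ ⦃a : A⦄ (f : b ⟶ U.obj a), ∃ F : GenericFactorization U f,
    ∀ G : GenericFactorization U f, Nonempty (Comparison U G F) ∧
      ∀ c c' : Comparison U G F, ∃! θ : c.e ≅ c'.e,
        θ.hom ▷ F.right ≫ c'.ω.hom = c.ω.hom ∧ G.left ◁ U.map₂ θ.hom ≫ c'.ν.hom = c.ν.hom

/-- A 1-cell `n : b ⟶ U a` is a local unit of `U` if it underlies the component at some
`f : b ⟶ U a₀` of the unit of some left biadjoint of the restriction `A/a₀ ⥤ᵖ B/U(a₀)`. -/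
def IsLocalUnit (U : A ⥤ᵖ B) {b : B} {a : A} (n : b ⟶ U.obj a) : Prop :=
  ∃ (a₀ : A) (Λ : LeftBiadjoint (sliceRestriction U a₀)) (f : b ⟶ U.obj a₀),
    (⟨(Λ.L.obj ⟨b, f⟩).left, (Λ.unit.app ⟨b, f⟩).left⟩ : Σ a' : A, b ⟶ U.obj a') = ⟨a, n⟩

end Stability

end TwoDimStability

/-!
Fix `n : b ⟶ U a` and `v : a ⟶ a₂`. The fillers of the pseudosquares from `n` with bottom side
`U(v)` exist and are unique in the required sense precisely when `n`, as a 1-cell of `B/U(a₂)` from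
`U(v) n` to `U(v)`, is biuniversal for `U_{a₂}`. Biuniversal 1-cells out of all objects assemble
into a left biadjoint, functoriality being forced by uniqueness of lifts. So a generic `n`, which
is generic at every `v`, yields unit components, and conversely the unit at `f` is generic at the
single 1-cell `L f`.

It remains to spread genericity from one `v₀` to every `v` when `U` is a local right biadjoint. If
`n` is generic at a composite `v w`, it is generic at `w`; in particular genericity at `v₀` implies
genericity at `𝟙`. Let `h` be the unit at `U(v) n` and `w` the induced 1-cell with `n ≅ U(w) h`.
Then `h` is generic at `w` and `n` is generic at `𝟙`, so `h` and `n` are both biuniversal out of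
`n` in `B/U(a)`; hence `w` is an equivalence, and `n` is generic at `v` because `h` is generic at
the composite of `v` with `w`.
-/

namespace TwoDimStability

section Biuniversal

variable {C : Type u₁} [Bicategory.{w₁, v₁} C] {D : Type u₂} [Bicategory.{w₂, v₂} D]

/-- A 1-cell `h : d ⟶ R c` is biuniversal from `d` to `R` if transposition along it is an
equivalence of hom-categories `C(c, u) ≌ D(d, R u)` for every `u`. The unit components of a left
biadjoint are such 1-cells, and a biuniversal 1-cell out of every `d` yields a left biadjoint. -/
def IsBiuniversal (R : C ⥤ᵖ D) {c : C} {d : D} (h : d ⟶ R.obj c) : Prop :=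
  ∀ u : C, (transpose R h u).IsEquivalence

/-- A lift of `k : d ⟶ d'` along `h : d ⟶ R c` and `h' : d' ⟶ R c'`: a 1-cell `map : c ⟶ c'` with
an invertible 2-cell `h' k ≅ R(map) h`. Lifts along biuniversal 1-cells are the values of a left
biadjoint on 1-cells. -/
structure Lift (R : C ⥤ᵖ D) {c c' : C} {d d' : D} (h : d ⟶ R.obj c) (h' : d' ⟶ R.obj c')
    (k : d ⟶ d') where
  map : c ⟶ c'
  iso : k ≫ h' ≅ h ≫ R.map map

namespace Lift

variable {R : C ⥤ᵖ D} {c c' c'' c''' : C} {d d' d'' d''' : D} {h : d ⟶ R.obj c}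
  {h' : d' ⟶ R.obj c'} {h'' : d'' ⟶ R.obj c''} {h''' : d''' ⟶ R.obj c'''}

/-- The identity 1-cell as a lift of the identity. -/
def id (R : C ⥤ᵖ D) {c : C} {d : D} (h : d ⟶ R.obj c) : Lift R h h (𝟙 d) where
  map := 𝟙 c
  iso := λ_ h ≪≫ (ρ_ h).symm ≪≫ whiskerLeftIso h (R.mapId c).symm

/-- The composite of two lifts, whose 2-cell is obtained by pasting. -/
def comp {k : d ⟶ d'} {l : d' ⟶ d''} (w : Lift R h h' k) (w' : Lift R h' h'' l) :
    Lift R h h'' (k ≫ l) where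
  map := w.map ≫ w'.map
  iso := α_ k l h'' ≪≫ whiskerLeftIso k w'.iso ≪≫ (α_ k h' (R.map w'.map)).symm ≪≫
    whiskerRightIso w.iso (R.map w'.map) ≪≫ α_ h (R.map w.map) (R.map w'.map) ≪≫
    whiskerLeftIso h (R.mapComp w.map w'.map).symm

/-- A 2-cell `σ` between lifts of `k` and `l` lies over `φ : k ⟶ l` if the square formed by `φ`,
`R(σ)` and the 2-cells of the lifts commutes. Over a biuniversal 1-cell exactly one `σ` does, so
that equations between 2-cells can be checked on what they lie over. -/
def LiesOver {k l : d ⟶ d'} (w : Lift R h h' k) (w' : Lift R h h' l) (φ : k ⟶ l)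
    (σ : w.map ⟶ w'.map) : Prop :=
  w.iso.hom ≫ h ◁ R.map₂ σ = φ ▷ h' ≫ w'.iso.hom

namespace LiesOver

theorem id {k : d ⟶ d'} (w : Lift R h h' k) : LiesOver w w (𝟙 k) (𝟙 w.map) := by
  simp [LiesOver]

theorem comp {k l m : d ⟶ d'} {w₁ : Lift R h h' k} {w₂ : Lift R h h' l} {w₃ : Lift R h h' m}
    {φ : k ⟶ l} {ψ : l ⟶ m} {σ : w₁.map ⟶ w₂.map} {τ : w₂.map ⟶ w₃.map}
    (hσ : LiesOver w₁ w₂ φ σ) (hτ : LiesOver w₂ w₃ ψ τ) : LiesOver w₁ w₃ (φ ≫ ψ) (σ ≫ τ) := by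
  unfold LiesOver at *
  simp [reassoc_of% hσ, hτ]

theorem whiskerLeft {k : d ⟶ d'} {l m : d' ⟶ d''} (w : Lift R h h' k)
    {w₁ : Lift R h' h'' l} {w₂ : Lift R h' h'' m} {φ : l ⟶ m} {σ : w₁.map ⟶ w₂.map}
    (hσ : LiesOver w₁ w₂ φ σ) : LiesOver (w.comp w₁) (w.comp w₂) (k ◁ φ) (w.map ◁ σ) := by
  have hkσ : k ◁ φ ▷ h'' ≫ k ◁ w₂.iso.hom = k ◁ w₁.iso.hom ≫ k ◁ h' ◁ R.map₂ σ := by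
    simp only [← Bicategory.whiskerLeft_comp, show _ = _ from hσ]
  have hwσ : k ◁ h' ◁ R.map₂ σ ≫ (α_ k h' _).inv ≫ w.iso.hom ▷ R.map w₂.map =
      (α_ k h' _).inv ≫ w.iso.hom ▷ R.map w₁.map ≫ (h ≫ R.map w.map) ◁ R.map₂ σ := by
    rw [associator_inv_naturality_right_assoc, whisker_exchange]
  simp [LiesOver, Lift.comp, reassoc_of% hkσ, reassoc_of% hwσ]

theorem whiskerRight {k l : d ⟶ d'} {m : d' ⟶ d''} {w₁ : Lift R h h' k} {w₂ : Lift R h h' l}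
    {φ : k ⟶ l} {σ : w₁.map ⟶ w₂.map} (hσ : LiesOver w₁ w₂ φ σ) (w : Lift R h' h'' m) :
    LiesOver (w₁.comp w) (w₂.comp w) (φ ▷ m) (σ ▷ w.map) := by
  have hσw : φ ▷ h' ▷ R.map w.map ≫ w₂.iso.hom ▷ R.map w.map =
      w₁.iso.hom ▷ R.map w.map ≫ (h ◁ R.map₂ σ) ▷ R.map w.map := by
    simp only [← comp_whiskerRight, show _ = _ from hσ]
  have hφw : φ ▷ m ▷ h'' ≫ (α_ l m h'').hom ≫ l ◁ w.iso.hom ≫ (α_ l h' _).inv =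
      (α_ k m h'').hom ≫ k ◁ w.iso.hom ≫ (α_ k h' _).inv ≫ φ ▷ h' ▷ R.map w.map := by
    rw [associator_naturality_left_assoc, ← whisker_exchange_assoc, associator_inv_naturality_left]
  simp [LiesOver, Lift.comp, reassoc_of% hφw, reassoc_of% hσw]

theorem associator {k : d ⟶ d'} {l : d' ⟶ d''} {m : d'' ⟶ d'''} (w : Lift R h h' k)
    (w' : Lift R h' h'' l) (w'' : Lift R h'' h''' m) :
    LiesOver ((w.comp w').comp w'') (w.comp (w'.comp w'')) (α_ k l m).hom
      (α_ w.map w'.map w''.map).hom := by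
  have hw : k ◁ h' ◁ (R.mapComp w'.map w''.map).inv ≫ (α_ k h' _).inv ≫
      w.iso.hom ▷ R.map (w'.map ≫ w''.map) = (α_ k h' _).inv ≫ w.iso.hom ▷ _ ≫
        (h ≫ R.map w.map) ◁ (R.mapComp w'.map w''.map).inv := by
    rw [associator_inv_naturality_right_assoc, whisker_exchange]
  simp [LiesOver, Lift.comp, reassoc_of% hw]

theorem leftUnitor {k : d ⟶ d'} (w : Lift R h h' k) :
    LiesOver ((Lift.id R h).comp w) w (λ_ k).hom (λ_ w.map).hom := by
  simp [LiesOver, Lift.comp, Lift.id]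

theorem rightUnitor {k : d ⟶ d'} (w : Lift R h h' k) :
    LiesOver (w.comp (Lift.id R h')) w (ρ_ k).hom (ρ_ w.map).hom := by
  have hw : k ◁ h' ◁ (R.mapId c').inv ≫ (α_ k h' _).inv ≫ w.iso.hom ▷ R.map (𝟙 c') =
      (α_ k h' _).inv ≫ w.iso.hom ▷ _ ≫ (h ≫ R.map w.map) ◁ (R.mapId c').inv := by
    rw [associator_inv_naturality_right_assoc, whisker_exchange]
  simp [LiesOver, Lift.comp, Lift.id, reassoc_of% hw]

theorem comp_mapId {w : Lift R h h (𝟙 d)} {σ : w.map ⟶ 𝟙 c}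
    (hσ : LiesOver w (Lift.id R h) (𝟙 (𝟙 d)) σ) :
    w.iso.hom ≫ h ◁ (R.map₂ σ ≫ (R.mapId c).hom) = 𝟙 (𝟙 d) ▷ h ≫ (λ_ h).hom ≫ (ρ_ h).inv := by
  simp only [LiesOver, Lift.id] at hσ
  simp [reassoc_of% hσ]

theorem comp_mapComp {k : d ⟶ d'} {l : d' ⟶ d''} {w : Lift R h h' k}
    {w' : Lift R h' h'' l} {w'' : Lift R h h'' (k ≫ l)} {σ : w''.map ⟶ w.map ≫ w'.map}
    (hσ : LiesOver w'' (w.comp w') (𝟙 (k ≫ l)) σ) :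
    w''.iso.hom ≫ h ◁ (R.map₂ σ ≫ (R.mapComp w.map w'.map).hom) =
      𝟙 (k ≫ l) ▷ h'' ≫ (α_ k l h'').hom ≫ k ◁ w'.iso.hom ≫ (α_ k h' (R.map w'.map)).inv ≫
        w.iso.hom ▷ R.map w'.map ≫ (α_ h (R.map w.map) (R.map w'.map)).hom := by
  simp only [LiesOver, Lift.comp] at hσ
  simp [reassoc_of% hσ]

end LiesOver

end Lift

namespace IsBiuniversal

section Lifting

variable {R : C ⥤ᵖ D} {c c' : C} {d d' : D} {h : d ⟶ R.obj c} (H : IsBiuniversal R h)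

/-- A chosen lift of `k` along a biuniversal 1-cell `h` and an arbitrary 1-cell `h'`. -/
noncomputable def lift (h' : d' ⟶ R.obj c') (k : d ⟶ d') : Lift R h h' k :=
  haveI := H c'
  ⟨(transpose R h c').objPreimage (k ≫ h'), ((transpose R h c').objObjPreimageIso (k ≫ h')).symm⟩

variable {h' : d' ⟶ R.obj c'} {k l : d ⟶ d'}

/-- The 2-cell between two lifts along a biuniversal 1-cell that lies over `φ`. -/
noncomputable def lift₂ (w : Lift R h h' k) (w' : Lift R h h' l) (φ : k ⟶ l) : w.map ⟶ w'.map :=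
  haveI := H c'
  (transpose R h c').preimage (w.iso.inv ≫ φ ▷ h' ≫ w'.iso.hom)

theorem liesOver_lift₂ (w : Lift R h h' k) (w' : Lift R h h' l) (φ : k ⟶ l) :
    w.LiesOver w' φ (H.lift₂ w w' φ) := by
  have := H c'
  exact (Iso.eq_inv_comp w.iso).1 ((transpose R h c').map_preimage _)

theorem lift₂_eq {w : Lift R h h' k} {w' : Lift R h h' l} {φ ψ : k ⟶ l} {σ : w.map ⟶ w'.map}
    (hσ : w.LiesOver w' ψ σ) (hφ : φ = ψ) : H.lift₂ w w' φ = σ := by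
  have := H c'
  subst hφ
  exact (transpose R h c').map_injective
    ((cancel_epi w.iso.hom).1 ((H.liesOver_lift₂ w w' φ).trans hσ.symm))

/-- The invertible 2-cell between two lifts along a biuniversal 1-cell that lies over an invertible
2-cell. -/
noncomputable def liftIso (w : Lift R h h' k) (w' : Lift R h h' l) (φ : k ≅ l) :
    w.map ≅ w'.map where
  hom := H.lift₂ w w' φ.hom
  inv := H.lift₂ w' w φ.inv
  hom_inv_id := by
    rw [← H.lift₂_eq ((H.liesOver_lift₂ w w' _).comp (H.liesOver_lift₂ w' w _)) rfl]
    exact H.lift₂_eq (.id w) φ.hom_inv_id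
  inv_hom_id := by
    rw [← H.lift₂_eq ((H.liesOver_lift₂ w' w _).comp (H.liesOver_lift₂ w w' _)) rfl]
    exact H.lift₂_eq (.id w') φ.inv_hom_id

end Lifting

section LeftBiadjoint

variable {R : C ⥤ᵖ D} {c : D → C} {h : ∀ d, d ⟶ R.obj (c d)} (H : ∀ d, IsBiuniversal R (h d))

open Lift in
/-- The left biadjoint determined by a biuniversal 1-cell out of every object: it lifts 1-cells and
2-cells, and its coherence holds because both sides of each axiom lie over the same 2-cell. -/
noncomputable def leftPseudofunctor : D ⥤ᵖ C where
  obj := c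
  map {d d'} k := ((H d).lift (h d') k).map
  map₂ {d _ _ _} φ := (H d).lift₂ _ _ φ
  mapId d := (H d).liftIso _ (Lift.id R (h d)) (Iso.refl _)
  mapComp {d d' d''} k l :=
    (H d).liftIso _ (((H d).lift (h d') k).comp ((H d').lift (h d'') l)) (Iso.refl _)
  map₂_id _ := (H _).lift₂_eq (.id _) rfl
  map₂_comp _ _ :=
    (H _).lift₂_eq (((H _).liesOver_lift₂ _ _ _).comp ((H _).liesOver_lift₂ _ _ _)) rfl
  map₂_whisker_left _ _ _ _ := (H _).lift₂_eq (((H _).liesOver_lift₂ _ _ _).comp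
    ((LiesOver.whiskerLeft _ ((H _).liesOver_lift₂ _ _ _)).comp ((H _).liesOver_lift₂ _ _ _)))
    (by simp)
  map₂_whisker_right _ _ := (H _).lift₂_eq (((H _).liesOver_lift₂ _ _ _).comp
    ((LiesOver.whiskerRight ((H _).liesOver_lift₂ _ _ _) _).comp ((H _).liesOver_lift₂ _ _ _)))
    (by simp)
  map₂_associator _ _ _ := (H _).lift₂_eq (((H _).liesOver_lift₂ _ _ _).comp
    ((LiesOver.whiskerRight ((H _).liesOver_lift₂ _ _ _) _).comp
      ((LiesOver.associator _ _ _).comp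
        ((LiesOver.whiskerLeft _ ((H _).liesOver_lift₂ _ _ _)).comp
          ((H _).liesOver_lift₂ _ _ _))))) (by simp)
  map₂_left_unitor _ := (H _).lift₂_eq (((H _).liesOver_lift₂ _ _ _).comp
    ((LiesOver.whiskerRight ((H _).liesOver_lift₂ _ _ _) _).comp (LiesOver.leftUnitor _))) (by simp)
  map₂_right_unitor _ := (H _).lift₂_eq (((H _).liesOver_lift₂ _ _ _).comp
    ((LiesOver.whiskerLeft _ ((H _).liesOver_lift₂ _ _ _)).comp (LiesOver.rightUnitor _))) (by simp)

/-- The left biadjoint of `R` whose unit is a given family of biuniversal 1-cells. -/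
noncomputable def leftBiadjoint : LeftBiadjoint R where
  L := leftPseudofunctor H
  unit :=
    { app := h
      naturality k := ((H _).lift _ k).iso
      naturality_naturality φ := ((H _).liesOver_lift₂ _ _ φ).symm
      naturality_id d := ((H d).liesOver_lift₂ _ _ _).comp_mapId
      naturality_comp _ _ := ((H _).liesOver_lift₂ _ _ _).comp_mapComp }
  isEquivalence_transpose d u := H d u

end LeftBiadjoint

end IsBiuniversal

theorem isEquivalence₁_of_iso {a b : C} {e : a ⟶ b} {g : b ⟶ a} (η : 𝟙 a ≅ e ≫ g)
    (ι : g ≫ e ≅ 𝟙 b) : IsEquivalence₁ e :=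
  ⟨Bicategory.Equivalence.mkOfAdjointifyCounit η ι, rfl⟩

theorem isEquivalence₁_of_comp_iso_id {a b : C} {e : a ⟶ b} {e' : b ⟶ a} {e'' : a ⟶ b}
    (ι : e' ≫ e ≅ 𝟙 b) (ι' : e'' ≫ e' ≅ 𝟙 a) : IsEquivalence₁ e :=
  let i : e'' ≅ e := (ρ_ e'').symm ≪≫ whiskerLeftIso e'' ι.symm ≪≫ (α_ e'' e' e).symm ≪≫
    whiskerRightIso ι' e ≪≫ λ_ e
  isEquivalence₁_of_iso (ι'.symm ≪≫ whiskerRightIso i e') ι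

theorem IsEquivalence₁.isEquivalence_precomp {a b : C} {e : a ⟶ b} (he : IsEquivalence₁ e) (x : C) :
    (precomp x e).IsEquivalence := by
  obtain ⟨E, rfl⟩ := he
  exact (CategoryTheory.Equivalence.mk (precomp x E.hom) (precomp x E.inv)
    ((leftUnitorNatIso b x).symm ≪≫ (precomposing b b x).mapIso E.counit.symm ≪≫
      associatorNatIsoRight E.inv E.hom x)
    ((associatorNatIsoRight E.hom E.inv x).symm ≪≫ (precomposing a a x).mapIso E.unit.symm ≪≫
      leftUnitorNatIso a x)).isEquivalence_functor

namespace IsBiuniversal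

variable {R : C ⥤ᵖ D} {c c' : C} {d : D} {h : d ⟶ R.obj c} {h' : d ⟶ R.obj c'}

theorem isEquivalence₁_lift (H : IsBiuniversal R h) (H' : IsBiuniversal R h')
    (w : Lift R h h' (𝟙 d)) : IsEquivalence₁ w.map :=
  let w' := H'.lift h (𝟙 d)
  isEquivalence₁_of_iso (H.liftIso (Lift.id R h) (w.comp w') (λ_ (𝟙 d)).symm)
    (H'.liftIso (w'.comp w) (Lift.id R h') (λ_ (𝟙 d)))

theorem of_isEquivalence₁ (H : IsBiuniversal R h) {e : c ⟶ c'} (he : IsEquivalence₁ e)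
    (κ : h ≫ R.map e ≅ h') : IsBiuniversal R h' := fun u => by
  have := H u
  have := he.isEquivalence_precomp u
  refine Functor.isEquivalence_of_iso (F := precomp u e ⋙ transpose R h u)
    (NatIso.ofComponents (fun k => whiskerLeftIso h (R.mapComp e k) ≪≫ (α_ _ _ _).symm ≪≫
      whiskerRightIso κ (R.map k)) fun {k l} σ => ?_)
  change h ◁ R.map₂ (e ◁ σ) ≫ h ◁ (R.mapComp e l).hom ≫ (α_ _ _ _).inv ≫ κ.hom ▷ R.map l =
    (h ◁ (R.mapComp e k).hom ≫ (α_ _ _ _).inv ≫ κ.hom ▷ R.map k) ≫ h' ◁ R.map₂ σ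
  simp [← whisker_exchange]

end IsBiuniversal

end Biuniversal

section Slice

variable {C : Type u₁} [Bicategory.{w₁, v₁} C] {x : C}

/-- The invertible 2-cell of the ambient bicategory underlying one of the pseudoslice. -/
def PseudoSlice.leftIso {f g : PseudoSlice x} {k l : f ⟶ g} (i : k ≅ l) : k.left ≅ l.left where
  hom := i.hom.left
  inv := i.inv.left
  hom_inv_id := congrArg Hom₂.left i.hom_inv_id
  inv_hom_id := congrArg Hom₂.left i.inv_hom_id

theorem IsEquivalence₁.left {f g : PseudoSlice x} {e : f ⟶ g} (he : IsEquivalence₁ e) :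
    IsEquivalence₁ e.left := by
  obtain ⟨E, rfl⟩ := he
  exact isEquivalence₁_of_iso (PseudoSlice.leftIso E.unit) (PseudoSlice.leftIso E.counit)

theorem IsEquivalence₁.exists_comp_iso_id_of_left {f g : PseudoSlice x} {e : f ⟶ g}
    (he : IsEquivalence₁ e.left) :
    ∃ e' : g ⟶ f, IsEquivalence₁ e'.left ∧ Nonempty (e' ≫ e ≅ 𝟙 g) := by
  obtain ⟨w, κ⟩ := e
  obtain ⟨E, rfl : E.hom = w⟩ := he
  let e' : g ⟶ f := ⟨E.inv, whiskerLeftIso E.inv κ.symm ≪≫ (α_ _ _ _).symm ≪≫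
    whiskerRightIso E.counit g.hom ≪≫ λ_ g.hom⟩
  exact ⟨e', isEquivalence₁_of_iso E.counit.symm E.unit.symm,
    ⟨PseudoSlice.mkIso E.counit (by simp [e'])⟩⟩

-- Splitting `e` twice avoids lifting the unit of the equivalence, which would need a triangle
-- identity.
theorem IsEquivalence₁.of_left {f g : PseudoSlice x} {e : f ⟶ g} (he : IsEquivalence₁ e.left) :
    IsEquivalence₁ e := by
  obtain ⟨e', he', ⟨ι⟩⟩ := he.exists_comp_iso_id_of_left
  obtain ⟨e'', -, ⟨ι'⟩⟩ := he'.exists_comp_iso_id_of_left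
  exact isEquivalence₁_of_comp_iso_id ι ι'

end Slice

section Generic

variable {A : Type u₁} [Bicategory.{w₁, v₁} A] {B : Type u₂} [Bicategory.{w₂, v₂} B]
  {U : A ⥤ᵖ B} {b : B} {a a₁ a₂ : A} {n : b ⟶ U.obj a} {v : a ⟶ a₂}

/-- The pseudosquare `U(u) (U(w) n) ≅ U(v) n` obtained from a triangle `ω : u w ≅ v` by applying
`U`, correcting by its compositor, and whiskering with `n`. A filler of a pseudosquare `α` is a
triangle `ω` with an invertible 2-cell `ν` from `α` to the pseudosquare of `ω`. -/
def pasteTriangle (U : A ⥤ᵖ B) (n : b ⟶ U.obj a) {w : a ⟶ a₁} {u : a₁ ⟶ a₂} (ω : w ≫ u ≅ v) :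
    (n ≫ U.map w) ≫ U.map u ≅ n ≫ U.map v :=
  α_ _ _ _ ≪≫ whiskerLeftIso n (U.mapComp w u).symm ≪≫ whiskerLeftIso n (U.map₂Iso ω)

theorem pasteTriangle_hom {w : a ⟶ a₁} {u : a₁ ⟶ a₂} (ω : w ≫ u ≅ v) :
    (pasteTriangle U n ω).hom = (α_ n (U.map w) (U.map u)).hom ≫ n ◁ (U.mapComp w u).inv ≫
      n ◁ U.map₂ ω.hom := rfl

theorem whiskerRight_comp_pasteTriangle_hom_eq_iff {w w' : a ⟶ a₁} {u : a₁ ⟶ a₂} {ω : w ≫ u ≅ v}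
    {ω' : w' ≫ u ≅ v} {σ : w ⟶ w'} :
    (n ◁ U.map₂ σ) ▷ U.map u ≫ (pasteTriangle U n ω').hom = (pasteTriangle U n ω).hom ↔
      n ◁ U.map₂ (σ ▷ u ≫ ω'.hom) = n ◁ U.map₂ ω.hom := by
  have hσ : (n ◁ U.map₂ σ) ▷ U.map u ≫ (pasteTriangle U n ω').hom =
      (α_ n (U.map w) (U.map u)).hom ≫ n ◁ (U.mapComp w u).inv ≫
        n ◁ U.map₂ (σ ▷ u ≫ ω'.hom) := by
    simp [pasteTriangle_hom]
  rw [hσ, pasteTriangle_hom, cancel_epi, cancel_epi]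

/-- Genericity of `n : b ⟶ U a` tested only against the pseudosquares with bottom side `U(v)`, for
a fixed `v`. The condition on 2-cells is imposed on the fillers in which `ν` is an identity; it
follows for all fillers by conjugating with `ν`. -/
structure IsGenericAt (U : A ⥤ᵖ B) {b : B} {a a₂ : A} (n : b ⟶ U.obj a) (v : a ⟶ a₂) : Prop where
  exists_filler {a₁ : A} (u : a₁ ⟶ a₂) (f : b ⟶ U.obj a₁) (α : f ≫ U.map u ≅ n ≫ U.map v) :
    Nonempty (Filler U n u v f α)
  existsUnique_map₂ {a₁ : A} {u : a₁ ⟶ a₂} {w w' : a ⟶ a₁} {ω : w ≫ u ≅ v} {ω' : w' ≫ u ≅ v}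
    (φ : n ≫ U.map w ⟶ n ≫ U.map w')
    (_ : φ ▷ U.map u ≫ (pasteTriangle U n ω').hom = (pasteTriangle U n ω).hom) :
    ∃! σ : w ⟶ w', σ ▷ u ≫ ω'.hom = ω.hom ∧ n ◁ U.map₂ σ = φ

namespace IsGenericAt

variable {w w' : a ⟶ a₁} {u : a₁ ⟶ a₂} {ω : w ≫ u ≅ v} {ω' : w' ≫ u ≅ v}

theorem hom_ext (H : IsGenericAt U n v) {σ τ : w ⟶ w'} (hσ : σ ▷ u ≫ ω'.hom = ω.hom)
    (hτ : τ ▷ u ≫ ω'.hom = ω.hom) (h : n ◁ U.map₂ σ = n ◁ U.map₂ τ) : σ = τ :=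
  (H.existsUnique_map₂ _ (whiskerRight_comp_pasteTriangle_hom_eq_iff.2 (by rw [hσ]))).unique
    ⟨hσ, rfl⟩ ⟨hτ, h.symm⟩

theorem exists_iso (H : IsGenericAt U n v) (φ : n ≫ U.map w ≅ n ≫ U.map w')
    (hφ : φ.hom ▷ U.map u ≫ (pasteTriangle U n ω').hom = (pasteTriangle U n ω).hom) :
    ∃ θ : w ≅ w', θ.hom ▷ u ≫ ω'.hom = ω.hom ∧ n ◁ U.map₂ θ.hom = φ.hom := by
  have hφ' : φ.inv ▷ U.map u ≫ (pasteTriangle U n ω).hom = (pasteTriangle U n ω').hom := by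
    simp [← hφ]
  obtain ⟨σ, ⟨hσ, hσφ⟩, -⟩ := H.existsUnique_map₂ φ.hom hφ
  obtain ⟨τ, ⟨hτ, hτφ⟩, -⟩ := H.existsUnique_map₂ φ.inv hφ'
  refine ⟨⟨σ, τ, H.hom_ext (ω := ω) (ω' := ω) ?_ ?_ ?_, H.hom_ext (ω := ω') (ω' := ω') ?_ ?_ ?_⟩,
    hσ, hσφ⟩ <;> simp [hσ, hτ, hσφ, hτφ]

end IsGenericAt

namespace Filler

variable {u : a₁ ⟶ a₂} {f f' : b ⟶ U.obj a₁} {α : f ≫ U.map u ≅ n ≫ U.map v}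
  {α' : f' ≫ U.map u ≅ n ≫ U.map v}

/-- A triangle as the filler of its own pseudosquare in which `ν` is the identity. -/
def ofTriangle (U : A ⥤ᵖ B) (n : b ⟶ U.obj a) {w : a ⟶ a₁} (ω : w ≫ u ≅ v) :
    Filler U n u v (n ≫ U.map w) (pasteTriangle U n ω) where
  diag := w
  ν := Iso.refl _
  ω := ω
  pasting := by simp [pasteTriangle_hom]

theorem ν_whiskerRight_comp_pasteTriangle (F : Filler U n u v f α) :
    F.ν.hom ▷ U.map u ≫ (pasteTriangle U n F.ω).hom = α.hom :=
  F.pasting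

theorem conj_whiskerRight_comp_pasteTriangle {φ : f ⟶ f'} (hφ : φ ▷ U.map u ≫ α'.hom = α.hom)
    (F : Filler U n u v f α) (F' : Filler U n u v f' α') :
    (F.ν.inv ≫ φ ≫ F'.ν.hom) ▷ U.map u ≫ (pasteTriangle U n F'.ω).hom =
      (pasteTriangle U n F.ω).hom := by
  simp [F'.ν_whiskerRight_comp_pasteTriangle, hφ, ← F.ν_whiskerRight_comp_pasteTriangle]

end Filler

theorem IsGeneric.isGenericAt (H : IsGeneric U n) (v : a ⟶ a₂) : IsGenericAt U n v where
  exists_filler u f α := H.exists_filler u v f α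
  existsUnique_map₂ {_ _ _ _ ω ω'} φ hφ := by
    simpa [Filler.ofTriangle] using
      H.existsUnique_two_cell φ hφ (Filler.ofTriangle U n ω) (Filler.ofTriangle U n ω')

theorem isGeneric_of_forall_isGenericAt (H : ∀ ⦃a₂ : A⦄ (v : a ⟶ a₂), IsGenericAt U n v) :
    IsGeneric U n where
  exists_filler u v f α := (H v).exists_filler u f α
  existsUnique_iso {_ _ _ v _ _} F F' := by
    obtain ⟨θ, hθ, hθν⟩ := (H v).exists_iso (F.ν.symm ≪≫ F'.ν)
      (by simpa using F.conj_whiskerRight_comp_pasteTriangle (φ := 𝟙 _) (by simp) F')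
    have hθν' : F.ν.hom ≫ n ◁ U.map₂ θ.hom = F'.ν.hom := by simp [hθν]
    exact ⟨θ, ⟨hθ, hθν'⟩, fun τ hτ => Iso.ext ((H v).hom_ext hτ.1 hθ
      ((cancel_epi F.ν.hom).1 (hτ.2.trans hθν'.symm)))⟩
  existsUnique_two_cell {_ _ _ v _ _ _ _} φ hφ F₁ F₂ := by
    simpa only [Iso.eq_inv_comp] using
      (H v).existsUnique_map₂ _ (F₁.conj_whiskerRight_comp_pasteTriangle hφ F₂)

section Slice

/- The composite `α ≫ n ◁ (mapComp⁻¹ ≫ U ω) ≫ κ` is the 2-cell of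
`(transpose (sliceRestriction U a₂) h x).obj w` unfolded, where `h` has 2-cell `κ` and `w` has
2-cell `ω`. -/
section Transpose

variable {g : b ⟶ U.obj a₂} {u : a₁ ⟶ a₂} {f : b ⟶ U.obj a₁} {w w' : a ⟶ a₁}

theorem whiskerRight_comp_transpose_eq_iff (κ : n ≫ U.map v ≅ g) {ω : w ≫ u ≅ v}
    {ν : f ⟶ n ≫ U.map w} {γ : f ≫ U.map u ⟶ g} :
    ν ▷ U.map u ≫ (α_ n (U.map w) (U.map u)).hom ≫
        n ◁ ((U.mapComp w u).inv ≫ U.map₂ ω.hom) ≫ κ.hom = γ ↔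
      ν ▷ U.map u ≫ (pasteTriangle U n ω).hom = γ ≫ κ.inv := by
  rw [Iso.eq_comp_inv]
  simp [pasteTriangle_hom]

theorem whiskerRight_comp_transpose_eq_transpose_iff (κ : n ≫ U.map v ≅ g) {ω : w ≫ u ≅ v}
    {ω' : w' ≫ u ≅ v} {φ : n ≫ U.map w ⟶ n ≫ U.map w'} :
    φ ▷ U.map u ≫ (α_ n (U.map w') (U.map u)).hom ≫
        n ◁ ((U.mapComp w' u).inv ≫ U.map₂ ω'.hom) ≫ κ.hom =
          (α_ n (U.map w) (U.map u)).hom ≫ n ◁ ((U.mapComp w u).inv ≫ U.map₂ ω.hom) ≫ κ.hom ↔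
      φ ▷ U.map u ≫ (pasteTriangle U n ω').hom = (pasteTriangle U n ω).hom := by
  rw [whiskerRight_comp_transpose_eq_iff]
  simp [pasteTriangle_hom]

end Transpose

variable {c : PseudoSlice a₂} {d : PseudoSlice (U.obj a₂)} {h : d ⟶ (sliceRestriction U a₂).obj c}

theorem IsBiuniversal.isGenericAt (H : IsBiuniversal (sliceRestriction U a₂) h) :
    IsGenericAt U (a := c.left) h.left c.hom where
  exists_filler {a₁} u f α := by
    let x : PseudoSlice a₂ := ⟨a₁, u⟩
    let k : d ⟶ (sliceRestriction U a₂).obj x := ⟨f, α ≪≫ h.iso⟩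
    have := H x
    obtain ⟨w, ⟨i⟩⟩ := Functor.EssSurj.mem_essImage (F := transpose _ h x) k
    have hi := (whiskerRight_comp_transpose_eq_iff (a := c.left) h.iso).1 i.inv.w
    exact ⟨⟨w.left, PseudoSlice.leftIso i.symm, w.iso, hi.trans ((Iso.comp_inv_eq h.iso).2 rfl)⟩⟩
  existsUnique_map₂ {a₁ u w w' ω ω'} φ hφ := by
    let x : PseudoSlice a₂ := ⟨a₁, u⟩
    let k : c ⟶ x := ⟨w, ω⟩
    let k' : c ⟶ x := ⟨w', ω'⟩
    have := H x
    let ψ : (transpose _ h x).obj k ⟶ (transpose _ h x).obj k' :=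
      ⟨φ, (whiskerRight_comp_transpose_eq_transpose_iff h.iso).2 hφ⟩
    obtain ⟨σ, hσ⟩ := (transpose _ h x).map_surjective ψ
    refine ⟨σ.left, ⟨σ.w, congrArg PseudoSlice.Hom₂.left hσ⟩, fun τ ⟨hτ, hτφ⟩ => ?_⟩
    have hτσ : (⟨τ, hτ⟩ : k ⟶ k') = σ :=
      (transpose _ h x).map_injective ((PseudoSlice.hom₂_ext hτφ).trans hσ.symm)
    exact congrArg PseudoSlice.Hom₂.left hτσ

theorem IsGenericAt.isBiuniversal (H : IsGenericAt U (a := c.left) h.left c.hom) :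
    IsBiuniversal (sliceRestriction U a₂) h := fun x =>
  { faithful := ⟨fun {_ _} σ τ hστ => PseudoSlice.hom₂_ext
      (H.hom_ext σ.w τ.w (congrArg PseudoSlice.Hom₂.left hστ))⟩
    full := ⟨fun {w w'} φ => by
      obtain ⟨σ, ⟨hσ, hσφ⟩, -⟩ := H.existsUnique_map₂ (ω := w.iso) (ω' := w'.iso) φ.left
        ((whiskerRight_comp_transpose_eq_transpose_iff h.iso).1 φ.w)
      exact ⟨⟨σ, hσ⟩, PseudoSlice.hom₂_ext hσφ⟩⟩
    essSurj := ⟨fun k => by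
      obtain ⟨F⟩ := H.exists_filler x.hom k.left (k.iso ≪≫ h.iso.symm)
      let w : c ⟶ x := ⟨F.diag, F.ω⟩
      exact ⟨w, ⟨(PseudoSlice.mkIso (k := k) (l := (transpose _ h x).obj w) F.ν
        ((whiskerRight_comp_transpose_eq_iff h.iso).2 F.pasting)).symm⟩⟩⟩ }

end Slice

section Cancellation

variable {a' : A} {w : a ⟶ a'} {v : a' ⟶ a₂} {v₀ : a ⟶ a₂} {u : a₁ ⟶ a'} {f f' : b ⟶ U.obj a₁}

/-- The triangle `v (u s) ≅ v₀` obtained by pasting triangles `v w ≅ v₀` and `u s ≅ w`. -/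
def extendTriangle (ω₀ : w ≫ v ≅ v₀) {s : a ⟶ a₁} (ω : s ≫ u ≅ w) : s ≫ u ≫ v ≅ v₀ :=
  (α_ _ _ _).symm ≪≫ whiskerRightIso ω v ≪≫ ω₀

/-- The pseudosquare with bottom side `U(v₀)` obtained by pasting a triangle `v w ≅ v₀` to a
pseudosquare with bottom side `U(w)`. -/
def extendSquare (ω₀ : w ≫ v ≅ v₀) (α : f ≫ U.map u ≅ n ≫ U.map w) :
    f ≫ U.map (u ≫ v) ≅ n ≫ U.map v₀ :=
  whiskerLeftIso f (U.mapComp u v) ≪≫ (α_ _ _ _).symm ≪≫ whiskerRightIso α (U.map v) ≪≫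
    pasteTriangle U n ω₀

theorem whiskerRight_comp_extendTriangle_hom_eq_iff {ω₀ : w ≫ v ≅ v₀} {s s' : a ⟶ a₁}
    {ω : s ≫ u ≅ w} {ω' : s' ≫ u ≅ w} {σ : s ⟶ s'} :
    σ ▷ (u ≫ v) ≫ (extendTriangle ω₀ ω').hom = (extendTriangle ω₀ ω).hom ↔
      (σ ▷ u ≫ ω'.hom) ▷ v ≫ ω₀.hom = ω.hom ▷ v ≫ ω₀.hom := by
  simp [extendTriangle]

theorem whiskerRight_comp_extendSquare_hom (ω₀ : w ≫ v ≅ v₀) {α : f ≫ U.map u ≅ n ≫ U.map w}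
    {α' : f' ≫ U.map u ≅ n ≫ U.map w} {φ : f ⟶ f'} (hφ : φ ▷ U.map u ≫ α'.hom = α.hom) :
    φ ▷ U.map (u ≫ v) ≫ (extendSquare ω₀ α').hom = (extendSquare ω₀ α).hom := by
  simp only [extendSquare, Iso.trans_hom, whiskerLeftIso_hom, Iso.symm_hom, whiskerRightIso_hom,
    ← hφ, comp_whiskerRight, Category.assoc]
  rw [← whisker_exchange_assoc, associator_inv_naturality_left_assoc]

theorem mapComp_inv_comp_map₂_associator_inv (U : A ⥤ᵖ B) {x y z t : A} (s : x ⟶ y) (u : y ⟶ z)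
    (v : z ⟶ t) :
    (U.mapComp s (u ≫ v)).inv ≫ U.map₂ (α_ s u v).inv ≫ (U.mapComp (s ≫ u) v).hom =
      U.map s ◁ (U.mapComp u v).hom ≫ (α_ _ _ _).inv ≫ (U.mapComp s u).inv ▷ U.map v := by
  rw [← Category.assoc, ← Iso.eq_comp_inv]
  simp [U.mapComp_assoc_left_inv s u v]

theorem extendSquare_pasteTriangle_hom (ω₀ : w ≫ v ≅ v₀) {s : a ⟶ a₁} (ω : s ≫ u ≅ w) :
    (extendSquare ω₀ (pasteTriangle U n ω)).hom =
      (pasteTriangle U n (extendTriangle ω₀ ω)).hom := by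
  have hU := congrArg (n ◁ ·) (mapComp_inv_comp_map₂_associator_inv U s u v)
  simp only [whiskerLeft_comp] at hU
  simp [extendSquare, extendTriangle, pasteTriangle_hom, reassoc_of% hU]

theorem extendSquare_hom_eq_iff {w' : a ⟶ a'} {ω₀ : w ≫ v ≅ v₀} {ω₀' : w' ≫ v ≅ v₀}
    {α : f ≫ U.map u ≅ n ≫ U.map w} {α' : f ≫ U.map u ≅ n ≫ U.map w'} :
    (extendSquare ω₀ α).hom = (extendSquare ω₀' α').hom ↔
      α.hom ▷ U.map v ≫ (pasteTriangle U n ω₀).hom =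
        α'.hom ▷ U.map v ≫ (pasteTriangle U n ω₀').hom := by
  simp only [extendSquare, Iso.trans_hom, whiskerRightIso_hom, cancel_epi]

theorem Filler.whiskerRight_comp_pasteTriangle_refl_whiskerRight {ω₀ : w ≫ v ≅ v₀}
    {α : f ≫ U.map u ≅ n ≫ U.map w} (F : Filler U n (u ≫ v) v₀ f (extendSquare ω₀ α)) :
    (whiskerRightIso F.ν (U.map u) ≪≫ pasteTriangle U n (Iso.refl (F.diag ≫ u))).hom ▷ U.map v ≫
        (pasteTriangle U n (α_ F.diag u v ≪≫ F.ω)).hom =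
      α.hom ▷ U.map v ≫ (pasteTriangle U n ω₀).hom := by
  have hω : extendTriangle (α_ F.diag u v ≪≫ F.ω) (Iso.refl (F.diag ≫ u)) = F.ω := by
    ext
    simp [extendTriangle]
  refine extendSquare_hom_eq_iff.1 ?_
  rw [← whiskerRight_comp_extendSquare_hom (φ := F.ν.hom) (α' := pasteTriangle U n (Iso.refl _)) _
    (by simp), extendSquare_pasteTriangle_hom, hω, F.ν_whiskerRight_comp_pasteTriangle]

theorem IsGenericAt.exists_filler_of_comp (H : IsGenericAt U n v₀) (ω₀ : w ≫ v ≅ v₀)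
    (α : f ≫ U.map u ≅ n ≫ U.map w) : Nonempty (Filler U n u w f α) := by
  obtain ⟨F⟩ := H.exists_filler (u ≫ v) f (extendSquare ω₀ α)
  let β : f ≫ U.map u ≅ n ≫ U.map (F.diag ≫ u) :=
    whiskerRightIso F.ν (U.map u) ≪≫ pasteTriangle U n (Iso.refl _)
  have hβ : (β.symm ≪≫ α).hom ▷ U.map v ≫ (pasteTriangle U n ω₀).hom =
      (pasteTriangle U n (α_ F.diag u v ≪≫ F.ω)).hom := by
    simp [← F.whiskerRight_comp_pasteTriangle_refl_whiskerRight, β]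
  obtain ⟨θ, -, hθ⟩ := H.exists_iso (β.symm ≪≫ α) hβ
  have hβθ : β.hom ≫ n ◁ U.map₂ θ.hom = α.hom := by simp [hθ]
  exact ⟨⟨F.diag, F.ν, θ, by simpa [β, pasteTriangle_hom] using hβθ⟩⟩

theorem IsGenericAt.of_comp (H : IsGenericAt U n v₀) (ω₀ : w ≫ v ≅ v₀) : IsGenericAt U n w where
  exists_filler _ _ α := H.exists_filler_of_comp ω₀ α
  existsUnique_map₂ {a₁ u s s' ω ω'} φ hφ := by
    obtain ⟨σ, ⟨hσ, rfl⟩, huniq⟩ := H.existsUnique_map₂ φ (by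
      simpa only [extendSquare_pasteTriangle_hom] using whiskerRight_comp_extendSquare_hom ω₀ hφ)
    have hσ' : σ ▷ u ≫ ω'.hom = ω.hom :=
      H.hom_ext (ω := whiskerRightIso ω v ≪≫ ω₀) (ω' := ω₀)
        (whiskerRight_comp_extendTriangle_hom_eq_iff.1 hσ) rfl
        (whiskerRight_comp_pasteTriangle_hom_eq_iff.1 hφ)
    exact ⟨σ, ⟨hσ', rfl⟩, fun τ hτ => huniq τ
      ⟨whiskerRight_comp_extendTriangle_hom_eq_iff.2 (by rw [hτ.1]), hτ.2⟩⟩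

end Cancellation

theorem pasteTriangle_rightUnitor_hom {w : a ⟶ a₁} :
    (pasteTriangle U n (ρ_ w)).hom = (n ≫ U.map w) ◁ (U.mapId a₁).hom ≫ (ρ_ _).hom := by
  simp [pasteTriangle_hom, U.map₂_right_unitor]

theorem isEquivalence₁_of_isGenericAt {a' : A} {h : b ⟶ U.obj a'} {w : a' ⟶ a}
    (Hh : IsGenericAt U h w) (Hn : IsGenericAt U n (𝟙 a)) (κ : h ≫ U.map w ≅ n) :
    IsEquivalence₁ w := by
  let d : PseudoSlice (U.obj a) := ⟨b, n⟩
  let x : PseudoSlice a := ⟨a', w⟩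
  let y : PseudoSlice a := ⟨a, 𝟙 a⟩
  let h₁ : d ⟶ (sliceRestriction U a).obj x := ⟨h, κ⟩
  let n₁ : d ⟶ (sliceRestriction U a).obj y := ⟨n, whiskerLeftIso n (U.mapId a) ≪≫ ρ_ n⟩
  have hκ : (λ_ n ≪≫ κ.symm).hom ▷ U.map (𝟙 a) ≫ (pasteTriangle U h (ρ_ w)).hom =
      ((α_ _ _ _).hom ≫ 𝟙 b ◁ (n ◁ (U.mapId a).hom ≫ (ρ_ n).hom) ≫ (λ_ n).hom) ≫ κ.inv := by
    rw [pasteTriangle_rightUnitor_hom, ← whisker_exchange_assoc]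
    simp
  let l : Lift (sliceRestriction U a) h₁ n₁ (𝟙 d) :=
    ⟨⟨w, ρ_ w⟩, PseudoSlice.mkIso _ ((whiskerRight_comp_transpose_eq_iff κ).2 hκ)⟩
  exact (IsBiuniversal.isEquivalence₁_lift (IsGenericAt.isBiuniversal (h := h₁) Hh)
    (IsGenericAt.isBiuniversal (h := n₁) Hn) l).left

theorem IsGenericAt.of_isEquivalence₁ {a' : A} {h : b ⟶ U.obj a'} {w : a' ⟶ a} {v₀ : a' ⟶ a₂}
    (H : IsGenericAt U h v₀) (hw : IsEquivalence₁ w) (κ : h ≫ U.map w ≅ n) (ω : w ≫ v ≅ v₀) :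
    IsGenericAt U n v := by
  let d : PseudoSlice (U.obj a₂) := ⟨b, n ≫ U.map v⟩
  let x : PseudoSlice a₂ := ⟨a', v₀⟩
  let y : PseudoSlice a₂ := ⟨a, v⟩
  let χ : h ≫ U.map v₀ ≅ n ≫ U.map v := (pasteTriangle U h ω).symm ≪≫ whiskerRightIso κ (U.map v)
  let h₁ : d ⟶ (sliceRestriction U a₂).obj x := ⟨h, χ⟩
  let n₁ : d ⟶ (sliceRestriction U a₂).obj y := ⟨n, Iso.refl _⟩
  let e : x ⟶ y := ⟨w, ω⟩
  have hκ : κ.symm.hom ▷ U.map v ≫ (pasteTriangle U h ω).hom = 𝟙 _ ≫ χ.inv := by simp [χ]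
  let i : n₁ ≅ h₁ ≫ (sliceRestriction U a₂).map e :=
    PseudoSlice.mkIso κ.symm ((whiskerRight_comp_transpose_eq_iff χ).2 hκ)
  exact IsBiuniversal.isGenericAt (h := n₁)
    ((IsGenericAt.isBiuniversal (h := h₁) H).of_isEquivalence₁ (IsEquivalence₁.of_left (e := e) hw)
      i.symm)

theorem IsGenericAt.isGeneric {v₀ : a ⟶ a₁} (H : IsGenericAt U n v₀)
    (hU : IsLocalRightBiadjoint U) : IsGeneric U n := by
  refine isGeneric_of_forall_isGenericAt fun a₂ v => ?_
  obtain ⟨Λ⟩ := hU a₂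
  let d : PseudoSlice (U.obj a₂) := ⟨b, n ≫ U.map v⟩
  let n₁ : d ⟶ (sliceRestriction U a₂).obj ⟨a, v⟩ := ⟨n, Iso.refl _⟩
  have Hh : IsBiuniversal (sliceRestriction U a₂) (c := Λ.L.obj d) (Λ.unit.app d) :=
    Λ.isEquivalence_transpose d
  let w := Hh.lift n₁ (𝟙 d)
  let κ : (Λ.unit.app d).left ≫ U.map w.map.left ≅ n := PseudoSlice.leftIso w.iso.symm ≪≫ λ_ n
  have hw : IsEquivalence₁ w.map.left :=
    isEquivalence₁_of_isGenericAt (Hh.isGenericAt.of_comp w.map.iso) (H.of_comp (λ_ v₀)) κ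
  exact Hh.isGenericAt.of_isEquivalence₁ hw κ w.map.iso

namespace LeftBiadjoint

theorem isGenericAt_unit (Λ : LeftBiadjoint (sliceRestriction U a)) (f : PseudoSlice (U.obj a)) :
    IsGenericAt U (a := (Λ.L.obj f).left) (Λ.unit.app f).left (Λ.L.obj f).hom :=
  IsBiuniversal.isGenericAt (Λ.isEquivalence_transpose f)

theorem isGeneric_unit (Λ : LeftBiadjoint (sliceRestriction U a)) (hU : IsLocalRightBiadjoint U)
    (f : PseudoSlice (U.obj a)) : IsGeneric U (a := (Λ.L.obj f).left) (Λ.unit.app f).left :=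
  (Λ.isGenericAt_unit f).isGeneric hU

theorem isGeneric_iff (Λ : LeftBiadjoint (sliceRestriction U a)) (hU : IsLocalRightBiadjoint U) :
    IsGeneric U n ↔ IsEquivalence₁ (Λ.L.obj ⟨b, n⟩).hom where
  mp H := isEquivalence₁_of_isGenericAt (Λ.isGenericAt_unit ⟨b, n⟩) (H.isGenericAt (𝟙 a))
    (Λ.unit.app ⟨b, n⟩).iso
  mpr H := isGeneric_of_forall_isGenericAt fun _ _ =>
    ((Λ.isGeneric_unit hU ⟨b, n⟩).isGenericAt _).of_isEquivalence₁ H (Λ.unit.app ⟨b, n⟩).iso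
      (Iso.refl _)

end LeftBiadjoint

theorem exists_leftBiadjoint (F : ∀ f : PseudoSlice (U.obj a), GenericFactorization U f.hom) :
    ∃ Λ : LeftBiadjoint (sliceRestriction U a), ∀ f : PseudoSlice (U.obj a),
      (⟨Λ.L.obj f, Λ.unit.app f⟩ : Σ u : PseudoSlice a, f ⟶ (sliceRestriction U a).obj u) =
        ⟨⟨(F f).mid, (F f).right⟩, ⟨(F f).left, (F f).iso⟩⟩ := by
  let h : ∀ f : PseudoSlice (U.obj a),
    f ⟶ (sliceRestriction U a).obj ⟨(F f).mid, (F f).right⟩ := fun f => ⟨(F f).left, (F f).iso⟩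
  have H : ∀ f, IsBiuniversal (sliceRestriction U a) (h f) := fun f =>
    IsGenericAt.isBiuniversal (h := h f) ((F f).generic.isGenericAt _)
  exact ⟨IsBiuniversal.leftBiadjoint H, fun f => rfl⟩

theorem IsBistable.isLocalRightBiadjoint (hU : IsBistable U) : IsLocalRightBiadjoint U := fun _ =>
  ⟨(exists_leftBiadjoint fun f => (hU f.hom).choose).choose⟩

section Comparison

theorem comparison_pasting_iff_filler_pasting {w : a ⟶ a₁} {u : a₁ ⟶ a₂}
    {f : b ⟶ U.obj a₁} {g : b ⟶ U.obj a₂} {ν : n ≫ U.map w ≅ f} {ω : w ≫ u ≅ v}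
    {χ : f ≫ U.map u ≅ g} {κ : n ≫ U.map v ≅ g} :
    n ◁ U.map₂ ω.inv ≫ n ◁ (U.mapComp w u).hom ≫ (α_ n (U.map w) (U.map u)).inv ≫
        ν.hom ▷ U.map u ≫ χ.hom = κ.hom ↔
      ν.inv ▷ U.map u ≫ (pasteTriangle U n ω).hom = (χ ≪≫ κ.symm).hom := by
  have hω : (pasteTriangle U n ω).inv =
      n ◁ U.map₂ ω.inv ≫ n ◁ (U.mapComp w u).hom ≫ (α_ n (U.map w) (U.map u)).inv := by
    simp [pasteTriangle]
  have hν : ν.inv ▷ U.map u = (whiskerRightIso ν (U.map u)).inv := rfl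
  rw [hν, Iso.trans_hom, Iso.symm_hom, Iso.eq_comp_inv, Category.assoc, Iso.inv_comp_eq,
    ← Iso.eq_inv_comp, hω, eq_comm]
  simp

variable {f : b ⟶ U.obj a} {G F : GenericFactorization U f}

/-- A comparison of generic factorizations as a filler of the pseudosquare they form, inverting the
2-cell `ν`. -/
def Comparison.filler (c : Comparison U G F) :
    Filler U G.left F.right G.right F.left (F.iso ≪≫ G.iso.symm) where
  diag := c.e
  ν := c.ν.symm
  ω := c.ω
  pasting := comparison_pasting_iff_filler_pasting.1 c.pasting

theorem Comparison.existsUnique_iso (c c' : Comparison U G F) :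
    ∃! θ : c.e ≅ c'.e,
      θ.hom ▷ F.right ≫ c'.ω.hom = c.ω.hom ∧ G.left ◁ U.map₂ θ.hom ≫ c'.ν.hom = c.ν.hom := by
  have hfiller : ∃! θ : c.e ≅ c'.e,
      θ.hom ▷ F.right ≫ c'.ω.hom = c.ω.hom ∧ c.ν.inv ≫ G.left ◁ U.map₂ θ.hom = c'.ν.inv :=
    G.generic.existsUnique_iso c.filler c'.filler
  simpa only [Iso.inv_comp_eq, Iso.eq_comp_inv] using hfiller

theorem nonempty_comparison (G F : GenericFactorization U f) : Nonempty (Comparison U G F) := by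
  obtain ⟨K⟩ := G.generic.exists_filler F.right G.right F.left (F.iso ≪≫ G.iso.symm)
  have hK : IsEquivalence₁ K.diag :=
    isEquivalence₁_of_isGenericAt (G.generic.isGenericAt _) (F.generic.isGenericAt _) K.ν.symm
  exact ⟨⟨K.diag, hK, K.ν.symm, K.ω, comparison_pasting_iff_filler_pasting.2 K.pasting⟩⟩

end Comparison

theorem IsLocalRightBiadjoint.isBistable (hU : IsLocalRightBiadjoint U) : IsBistable U := by
  intro b a f
  obtain ⟨Λ⟩ := hU a
  let F : GenericFactorization U f :=
    ⟨(Λ.L.obj ⟨b, f⟩).left, (Λ.unit.app ⟨b, f⟩).left, (Λ.L.obj ⟨b, f⟩).hom,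
      (Λ.unit.app ⟨b, f⟩).iso, Λ.isGeneric_unit hU ⟨b, f⟩⟩
  exact ⟨F, fun G => ⟨nonempty_comparison G F, Comparison.existsUnique_iso⟩⟩

theorem IsLocalUnit.isGeneric (hU : IsLocalRightBiadjoint U) (hn : IsLocalUnit U n) :
    IsGeneric U n := by
  obtain ⟨_, Λ, f, h⟩ := hn
  exact (congrArg (fun p : Σ a' : A, b ⟶ U.obj a' => IsGeneric U p.2) h).mp
    (Λ.isGeneric_unit hU ⟨b, f⟩)

theorem IsGeneric.isLocalUnit (hU : IsBistable U) (hn : IsGeneric U n) : IsLocalUnit U n := by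
  classical
  let G : GenericFactorization U n := ⟨a, n, 𝟙 a, whiskerLeftIso n (U.mapId a) ≪≫ ρ_ n, hn⟩
  let F : ∀ f : PseudoSlice (U.obj a), GenericFactorization U f.hom :=
    Function.update (fun f => (hU f.hom).choose) ⟨b, n⟩ G
  have hF : F ⟨b, n⟩ = G := Function.update_self _ _ _
  obtain ⟨Λ, hΛ⟩ := exists_leftBiadjoint F
  have hΛn := hΛ ⟨b, n⟩
  rw [hF] at hΛn
  exact ⟨a, Λ, n, congrArg (fun p : Σ u : PseudoSlice a,
    (⟨b, n⟩ : PseudoSlice (U.obj a)) ⟶ (sliceRestriction U a).obj u =>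
      (⟨p.1.left, p.2.left⟩ : Σ a' : A, b ⟶ U.obj a')) hΛn⟩

end Generic

end TwoDimStability

open TwoDimStability in
theorem mainTheorem2 {A : Type u₁} [Bicategory.{w₁, v₁} A] {B : Type u₂} [Bicategory.{w₂, v₂} B]
    (U : A ⥤ᵖ B) :
    (IsBistable U ↔ IsLocalRightBiadjoint U) ∧
    -- the local units are exactly the generic 1-cells
    (IsBistable U → ∀ ⦃b : B⦄ ⦃a : A⦄ (n : b ⟶ U.obj a), IsGeneric U n ↔ IsLocalUnit U n) ∧
    -- for any choice of local left biadjoints, the unit components are generic, and the generic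
    -- 1-cells are those sent to equivalences
    (∀ Λ : ∀ a : A, LeftBiadjoint (sliceRestriction U a),
      (∀ (a : A) (f : PseudoSlice (U.obj a)),
        IsGeneric U (a := ((Λ a).L.obj f).left) ((Λ a).unit.app f).left) ∧
      ∀ ⦃b : B⦄ ⦃a : A⦄ (n : b ⟶ U.obj a),
        IsGeneric U n ↔ IsEquivalence₁ ((Λ a).L.obj ⟨b, n⟩).hom) ∧
    -- any choice of generic factorizations over `a` is the unit of a local left biadjoint at `a`
    (∀ (a : A) (F : ∀ f : PseudoSlice (U.obj a), GenericFactorization U f.hom),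
      ∃ Λ : LeftBiadjoint (sliceRestriction U a), ∀ f : PseudoSlice (U.obj a),
        (⟨Λ.L.obj f, Λ.unit.app f⟩ :
          Σ u : PseudoSlice a, f ⟶ (sliceRestriction U a).obj u) =
        ⟨⟨(F f).mid, (F f).right⟩, ⟨(F f).left, (F f).iso⟩⟩) := by
  refine ⟨⟨IsBistable.isLocalRightBiadjoint, IsLocalRightBiadjoint.isBistable⟩, ?_, ?_, ?_⟩
  · exact fun hU b a n => ⟨fun hn => hn.isLocalUnit hU,
      fun hn => hn.isGeneric hU.isLocalRightBiadjoint⟩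
  · intro Λ
    have hU : IsLocalRightBiadjoint U := fun a => ⟨Λ a⟩
    exact ⟨fun a f => (Λ a).isGeneric_unit hU f, fun b a n => (Λ a).isGeneric_iff hU⟩
  · exact fun a F => exists_leftBiadjoint F
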